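/- Let $K$ be an infinite field, and for $n,r\in\mathbb{N}$ with $n\ge 1$ let $\widetilde{S}(n,r)$ be the affine Schur algebra, defined as follows. Let $I(\mathbb{Z},r)$ be the set of $r$-tuples of integers, on which the extended affine Weyl group $\widehat{\Sigma}_r=\Sigma_r\ltimes\mathbb{Z}^r$ acts on the right, $\Sigma_r$ by place permutation and $\varepsilon\in\mathbb{Z}^r$ by $\underline{i}\mapsto\underline{i}+n\varepsilon$; let it act diagonally on $I(\mathbb{Z},r)\times I(\mathbb{Z},r)$, and write $\sim$ for lying in the same orbit. Then $\widetilde{S}(n,r)$ is the $K$-algebra with one basis element $\xi_{\underline{i},\underline{j}}$ for each $\widehat{\Sigma}_r$-orbit of pairs $(\underline{i},\underline{j})$ (so that $\xi_{\underline{i},\underline{j}}=\xi_{\underline{k},\underline{l}}$ if and only if $(\underline{i},\underline{j})\sim(\underline{k},\underline{l})$) and with multiplication $$\xi_{\underline{i},\underline{j}}\,\xi_{\underline{k},\underline{l}}=\sum_{(\underline{p},\underline{q})}\#\{\underline{s}\in I(\mathbb{Z},r) : (\underline{i},\underline{j})\sim(\underline{p},\underline{s}),\ (\underline{s},\underline{q})\sim(\underline{k},\underline{l})\}\;\xi_{\underline{p},\underline{q}},$$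 where $(\underline{p},\underline{q})$ runs over representatives of the $\widehat{\Sigma}_r$-orbits of $I(\mathbb{Z},r)\times I(\mathbb{Z},r)$. Theorem. If $n\ge r$, then the $K$-algebras $\widetilde{S}(n+1,r)$ and $\widetilde{S}(n,r)$ are Morita equivalent, that is, their categories of left modules are equivalent by a $K$-linear equivalence. -/

import Mathlib

namespace AffineSchur

/-- `I(ℤ, r)`: the `r`-tuples of integers. -/
abbrev MultiIndex (r : ℕ) : Type := Fin r → ℤ

/-- The right action on `I(ℤ, r)` of the element `σ ε` of the extended affine Weyl group
`Σ_r ⋉ ℤ^r` (every element is uniquely of this form): first the place permutation `σ`, then the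
shift by `n ε`. -/
def act (n : ℕ) {r : ℕ} (σ : Equiv.Perm (Fin r)) (ε : Fin r → ℤ) :
    MultiIndex r ≃ MultiIndex r where
  toFun i := fun t => i (σ t) + n * ε t
  invFun i := fun t => i (σ.symm t) - n * ε (σ.symm t)
  left_inv i := by ext t; simp
  right_inv i := by ext t; simp

/-- `(i, j) ∼ (k, l)`: the two pairs lie in the same orbit of the diagonal action of the extended
affine Weyl group on `I(ℤ, r) × I(ℤ, r)`. -/
def orbitSetoid (n r : ℕ) : Setoid (MultiIndex r × MultiIndex r) where
  r x y := ∃ (σ : Equiv.Perm (Fin r)) (ε : Fin r → ℤ), act n σ ε x.1 = y.1 ∧ act n σ ε x.2 = y.2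
  iseqv :=
    { refl := fun x => ⟨1, 0, by ext t; simp [act], by ext t; simp [act]⟩
      symm := by
        rintro ⟨i, j⟩ ⟨k, l⟩ ⟨σ, ε, h1, h2⟩
        refine ⟨σ.symm, fun t => - ε (σ.symm t), ?_, ?_⟩
        · rw [← h1]; ext t; simp [act]
        · rw [← h2]; ext t; simp [act]
      trans := by
        rintro ⟨i, j⟩ ⟨k, l⟩ ⟨p, q⟩ ⟨σ, ε, h1, h2⟩ ⟨τ, δ, h3, h4⟩
        refine ⟨τ.trans σ, fun t => ε (τ t) + δ t, ?_, ?_⟩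
        · rw [← h3, ← h1]; ext t; simp [act]; ring
        · rw [← h4, ← h2]; ext t; simp [act]; ring }

/-- The set of orbits of the extended affine Weyl group on `I(ℤ, r) × I(ℤ, r)`. -/
def Orbit (n r : ℕ) : Type := Quotient (orbitSetoid n r)

/-- The orbit of the pair `(i, j)`. -/
def orb (n : ℕ) {r : ℕ} (i j : MultiIndex r) : Orbit n r := Quotient.mk (orbitSetoid n r) (i, j)

theorem orb_eq_iff {n r : ℕ} {i j k l : MultiIndex r} :
    orb n i j = orb n k l ↔ ∃ (σ : Equiv.Perm (Fin r)) (ε : Fin r → ℤ),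
      act n σ ε i = k ∧ act n σ ε j = l :=
  Quotient.eq (r := orbitSetoid n r)

theorem orb_act {n r : ℕ} (σ : Equiv.Perm (Fin r)) (ε : Fin r → ℤ) (i j : MultiIndex r) :
    orb n (act n σ ε i) (act n σ ε j) = orb n i j :=
  (orb_eq_iff.2 ⟨σ, ε, rfl, rfl⟩).symm

theorem exists_orb {n r : ℕ} (o : Orbit n r) : ∃ i j, orb n i j = o := by
  obtain ⟨⟨i, j⟩, rfl⟩ := Quotient.exists_rep o
  exact ⟨i, j, rfl⟩

/-- The number `Z(i,j,k,l,p,q)` of those `s` in `I(ℤ, r)` with `(i,j) ∼ (p,s)` and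
`(s,q) ∼ (k,l)`, as a function of the orbit `a` of `(i,j)`, the orbit `b` of `(k,l)`, and of
`p`, `q`. -/
noncomputable def structConstAt {n r : ℕ} (a b : Orbit n r) (p q : MultiIndex r) : ℕ :=
  Nat.card {s : MultiIndex r // a = orb n p s ∧ orb n s q = b}

theorem structConstAt_act {n r : ℕ} (a b : Orbit n r) (σ : Equiv.Perm (Fin r)) (ε : Fin r → ℤ)
    (p q : MultiIndex r) :
    structConstAt a b p q = structConstAt a b (act n σ ε p) (act n σ ε q) :=
  Nat.card_congr ((act n σ ε).subtypeEquiv fun s => by rw [orb_act, orb_act])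

/-- The structure constants, as a function of three orbits. -/
noncomputable def structConst {n r : ℕ} (a b o : Orbit n r) : ℕ :=
  Quotient.lift (s := orbitSetoid n r) (fun x => structConstAt a b x.1 x.2)
    (by
      rintro ⟨p, q⟩ ⟨p', q'⟩ ⟨σ, ε, h1, h2⟩
      simp only at h1 h2 ⊢
      rw [← h1, ← h2]
      exact structConstAt_act a b σ ε p q) o

theorem structConst_orb {n r : ℕ} (a b : Orbit n r) (p q : MultiIndex r) :
    structConst a b (orb n p q) = structConstAt a b p q := rfl

theorem finite_row {n r : ℕ} (p : MultiIndex r) (a : Orbit n r) :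
    {s : MultiIndex r | a = orb n p s}.Finite := by
  obtain ⟨i, j, rfl⟩ := exists_orb a
  refine (Set.finite_range fun σ : Equiv.Perm (Fin r) =>
    (fun t => j (σ t) + p t - i (σ t) : MultiIndex r)).subset ?_
  intro s hs
  obtain ⟨σ, ε, h1, h2⟩ := orb_eq_iff.1 (hs : orb n i j = orb n p s)
  refine ⟨σ, ?_⟩
  rw [← h1, ← h2]
  ext t
  simp only [act, Equiv.coe_fn_mk]
  ring

theorem finite_structConst {n r : ℕ} (a b : Orbit n r) :
    {o : Orbit n r | structConst a b o ≠ 0}.Finite := by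
  obtain ⟨i, j, rfl⟩ := exists_orb a
  refine ((finite_row i (orb n i j)).biUnion fun s _ =>
    (finite_row s b).image (orb n i)).subset ?_
  intro o ho
  obtain ⟨p, q, rfl⟩ := exists_orb o
  rw [Set.mem_ofPred_eq, structConst_orb] at ho
  obtain ⟨⟨s, h1, h2⟩⟩ := (Nat.card_ne_zero.1 ho).1
  obtain ⟨σ, ε, h3, h4⟩ := orb_eq_iff.1 h1.symm
  refine Set.mem_biUnion (x := act n σ ε s) ?_ ⟨act n σ ε q, ?_, ?_⟩
  · rw [Set.mem_ofPred_eq, h4]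
  · rw [Set.mem_ofPred_eq, orb_act, h2]
  · rw [← h3, orb_act]

theorem finite_diagonal (n r : ℕ) [NeZero n] :
    {o : Orbit n r | ∃ i : MultiIndex r, o = orb n i i}.Finite := by
  refine (Set.finite_range fun c : Fin r → Fin n =>
    orb n (fun t => (c t : ℤ)) (fun t => (c t : ℤ))).subset ?_
  rintro _ ⟨i, rfl⟩
  have hn : (n : ℤ) ≠ 0 := by exact_mod_cast NeZero.ne n
  have hn' : (0 : ℤ) < n := by exact_mod_cast Nat.pos_of_ne_zero (NeZero.ne n)
  have hlt : ∀ t, (i t % n).toNat < n := fun t => by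
    have := Int.emod_nonneg (i t) hn
    have := Int.emod_lt_of_pos (i t) hn'
    omega
  have h : act n 1 (fun t => i t / n)
      (fun t => (((⟨(i t % n).toNat, hlt t⟩ : Fin n) : ℕ) : ℤ)) = i := by
    ext t
    simp only [act, Equiv.coe_fn_mk, Equiv.Perm.coe_one, id_eq]
    rw [Int.toNat_of_nonneg (Int.emod_nonneg (i t) hn), Int.emod_add_mul_ediv]
  exact ⟨fun t => ⟨(i t % n).toNat, hlt t⟩, orb_eq_iff.2 ⟨1, fun t => i t / n, h, h⟩⟩

theorem orb_eq_diagonal_iff {n r : ℕ} (p q : MultiIndex r) :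
    (∃ i : MultiIndex r, orb n p q = orb n i i) ↔ p = q := by
  constructor
  · rintro ⟨i, h⟩
    obtain ⟨σ, ε, h1, h2⟩ := orb_eq_iff.1 h
    exact (act n σ ε).injective (h1.trans h2.symm)
  · rintro rfl
    exact ⟨p, rfl⟩

end AffineSchur

open AffineSchur in
/-- The affine Schur algebra `S̃(n, r)` over `K`: the free `K`-module with one basis element
`ξ_{i,j}` for every orbit of the extended affine Weyl group on `I(ℤ, r) × I(ℤ, r)`. -/
def AffineSchurAlgebra (K : Type*) [CommRing K] (n r : ℕ) : Type _ := Orbit n r →₀ K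

namespace AffineSchurAlgebra

open AffineSchur

noncomputable section

variable {K : Type*} [CommRing K] {n r : ℕ}

instance instAddCommGroup : AddCommGroup (AffineSchurAlgebra K n r) :=
  inferInstanceAs (AddCommGroup (Orbit n r →₀ K))

instance instModule : Module K (AffineSchurAlgebra K n r) :=
  inferInstanceAs (Module K (Orbit n r →₀ K))

/-- The coefficient of the basis element of an orbit. -/
def coeff (f : AffineSchurAlgebra K n r) (o : Orbit n r) : K :=
  DFunLike.coe (F := Orbit n r →₀ K) f o

/-- The basis element `ξ_{i,j}`. -/
def xi (K : Type*) [CommRing K] (n : ℕ) {r : ℕ} (i j : MultiIndex r) : AffineSchurAlgebra K n r :=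
  Finsupp.single (orb n i j) 1

/-- The product of the basis elements of the orbits `a` and `b`: the sum over all orbits `o` of
the structure constant times the basis element of `o`. -/
def basisMul (K : Type*) [CommRing K] {n r : ℕ} (a b : Orbit n r) : AffineSchurAlgebra K n r :=
  Finsupp.ofSupportFinite (fun o => (structConst a b o : K))
    ((finite_structConst a b).subset fun o ho h => ho (by simp [h]))

/-- The bilinear extension of the product of basis elements. -/
instance instMul : Mul (AffineSchurAlgebra K n r) where
  mul f g := Finsupp.sum (M := K) f fun a x => Finsupp.sum (M := K) g fun b y =>
    (x * y) • basisMul K a b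

/-- The identity, the sum of the `ξ_{i,i}` over the orbits of `(i,i)`. -/
instance instOne [NeZero n] : One (AffineSchurAlgebra K n r) where
  one := ∑ o ∈ (finite_diagonal n r).toFinset,
    (Finsupp.single o 1 : Orbit n r →₀ K)

/-- The defining product formula for the basis elements, coefficient by coefficient. -/
theorem coeff_xi_mul_xi (i j k l p q : MultiIndex r) :
    (xi K n i j * xi K n k l).coeff (orb n p q) =
      (Nat.card {s : MultiIndex r // orb n i j = orb n p s ∧ orb n s q = orb n k l} : K) := by
  have h : xi K n i j * xi K n k l = basisMul K (orb n i j) (orb n k l) := by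
    change Finsupp.sum (M := K) (Finsupp.single (orb n i j) 1) (fun a x =>
      Finsupp.sum (M := K) (Finsupp.single (orb n k l) 1) fun b y =>
        (x * y) • basisMul K a b) = _
    rw [Finsupp.sum_single_index (by simp), Finsupp.sum_single_index (by simp), mul_one, one_smul]
  rw [h]
  rfl

theorem ext_coeff {f g : AffineSchurAlgebra K n r}
    (h : ∀ p q, f.coeff (orb n p q) = g.coeff (orb n p q)) : f = g := by
  refine Finsupp.ext (f := f) (g := g) fun o => ?_
  obtain ⟨p, q, rfl⟩ := exists_orb o
  exact h p q

theorem coeff_add (f g : AffineSchurAlgebra K n r) (o : Orbit n r) :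
    (f + g).coeff o = f.coeff o + g.coeff o := rfl

theorem coeff_zero (o : Orbit n r) : (0 : AffineSchurAlgebra K n r).coeff o = 0 := rfl

theorem coeff_smul (c : K) (f : AffineSchurAlgebra K n r) (o : Orbit n r) :
    (c • f).coeff o = c * f.coeff o := rfl

theorem coeff_sum {ι : Type*} (F : Finset ι) (v : ι → AffineSchurAlgebra K n r) (o : Orbit n r) :
    (∑ a ∈ F, v a).coeff o = ∑ a ∈ F, (v a).coeff o :=
  map_sum (⟨⟨fun f => f.coeff o, rfl⟩, fun _ _ => rfl⟩ : AffineSchurAlgebra K n r →+ K) v F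

open Classical in
theorem coeff_one [NeZero n] (p q : MultiIndex r) :
    (1 : AffineSchurAlgebra K n r).coeff (orb n p q) = if p = q then 1 else 0 := by
  change (∑ o ∈ (finite_diagonal n r).toFinset, (Finsupp.single o 1 : Orbit n r →₀ K))
    (orb n p q) = _
  rw [Finsupp.finsetSum_apply]
  simp only [Finsupp.single_apply, Finset.sum_ite_eq', Set.Finite.mem_toFinset, Set.mem_ofPred_eq,
    orb_eq_diagonal_iff]

theorem finite_coeff_row (f : AffineSchurAlgebra K n r) (p : MultiIndex r) :
    {s : MultiIndex r | f.coeff (orb n p s) ≠ 0}.Finite := by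
  refine ((Finsupp.support (M := K) f).finite_toSet.biUnion fun a _ => finite_row p a).subset ?_
  intro s hs
  exact Set.mem_biUnion (x := orb n p s) (Finsupp.mem_support_iff.2 hs) rfl

open Classical in
theorem structConstAt_eq_sum (a b : Orbit n r) (p q : MultiIndex r) (T : Finset (MultiIndex r))
    (hT : ∀ s, a = orb n p s → s ∈ T) :
    (structConstAt a b p q : K) =
      ∑ s ∈ T, (if a = orb n p s then 1 else 0) * (if b = orb n s q then 1 else 0) := by
  have h : structConstAt a b p q = (T.filter fun s => a = orb n p s ∧ b = orb n s q).card := by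
    refine Nat.subtype_card _ fun s => ?_
    rw [Finset.mem_filter, eq_comm (a := b)]
    exact ⟨fun h => h.2, fun h => ⟨hT s h.1, h⟩⟩
  rw [h, Finset.card_filter, Nat.cast_sum]
  refine Finset.sum_congr rfl fun s _ => ?_
  by_cases h1 : a = orb n p s <;> by_cases h2 : b = orb n s q <;> simp [h1, h2]

/-- The coefficients of a product are those of a product of (row-finite) matrices. -/
theorem coeff_mul (f g : AffineSchurAlgebra K n r) (p q : MultiIndex r)
    (T : Finset (MultiIndex r)) (hT : ∀ s, f.coeff (orb n p s) ≠ 0 → s ∈ T) :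
    (f * g).coeff (orb n p q) = ∑ s ∈ T, f.coeff (orb n p s) * g.coeff (orb n s q) := by
  classical
  let F : Finset (Orbit n r) := Finsupp.support (M := K) f
  let G : Finset (Orbit n r) := Finsupp.support (M := K) g
  have hF : ∀ o, f.coeff o = ∑ a ∈ F, f.coeff a * (if a = o then 1 else 0) := fun o => by
    simp only [mul_ite, mul_one, mul_zero, Finset.sum_ite_eq']
    split_ifs with h
    · rfl
    · exact Finsupp.notMem_support_iff.1 h
  have hG : ∀ o, g.coeff o = ∑ b ∈ G, g.coeff b * (if b = o then 1 else 0) := fun o => by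
    simp only [mul_ite, mul_one, mul_zero, Finset.sum_ite_eq']
    split_ifs with h
    · rfl
    · exact Finsupp.notMem_support_iff.1 h
  have h1 : (f * g).coeff (orb n p q) =
      ∑ a ∈ F, ∑ b ∈ G, f.coeff a * g.coeff b * (structConstAt a b p q : K) := by
    change (∑ a ∈ F, ∑ b ∈ G, (f.coeff a * g.coeff b) • basisMul K a b).coeff (orb n p q) = _
    simp only [coeff_sum]
    rfl
  let T' : Finset (MultiIndex r) :=
    T ∪ (F.finite_toSet.biUnion fun a _ => finite_row p a).toFinset
  have hT' : ∀ a ∈ F, ∀ s, a = orb n p s → s ∈ T' := fun a ha s hs =>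
    Finset.mem_union_right _ ((Set.Finite.mem_toFinset _).2 (Set.mem_biUnion ha hs))
  have h2 : ∑ s ∈ T, f.coeff (orb n p s) * g.coeff (orb n s q) =
      ∑ s ∈ T', f.coeff (orb n p s) * g.coeff (orb n s q) := by
    refine Finset.sum_subset Finset.subset_union_left fun s _ hs => ?_
    rw [not_not.1 (mt (hT s) hs), zero_mul]
  have h3 : ∀ s, f.coeff (orb n p s) * g.coeff (orb n s q) =
      ∑ a ∈ F, ∑ b ∈ G, f.coeff a * g.coeff b *
        ((if a = orb n p s then 1 else 0) * (if b = orb n s q then 1 else 0)) := fun s => by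
    conv_lhs => rw [hF, hG (orb n s q), Finset.sum_mul_sum]
    refine Finset.sum_congr rfl fun a _ => Finset.sum_congr rfl fun b _ => ?_
    ring
  rw [h1, h2, Finset.sum_congr rfl fun s _ => h3 s, Finset.sum_comm (s := T')]
  refine Finset.sum_congr rfl fun a ha => ?_
  rw [Finset.sum_comm (s := T')]
  refine Finset.sum_congr rfl fun b _ => ?_
  rw [← Finset.mul_sum, structConstAt_eq_sum a b p q T' (hT' a ha)]

/-- The finitely many `s` for which the coefficient of `f` at `(p, s)` is nonzero. -/
def row (f : AffineSchurAlgebra K n r) (p : MultiIndex r) : Finset (MultiIndex r) :=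
  (finite_coeff_row f p).toFinset

theorem mem_row (f : AffineSchurAlgebra K n r) (p s : MultiIndex r)
    (h : f.coeff (orb n p s) ≠ 0) : s ∈ f.row p :=
  (Set.Finite.mem_toFinset _).2 h

protected theorem mul_add (f g h : AffineSchurAlgebra K n r) : f * (g + h) = f * g + f * h :=
  ext_coeff fun p q => by
    rw [coeff_add, coeff_mul _ _ p q _ (mem_row f p), coeff_mul _ _ p q _ (mem_row f p),
      coeff_mul _ _ p q _ (mem_row f p), ← Finset.sum_add_distrib]
    exact Finset.sum_congr rfl fun s _ => by rw [coeff_add, mul_add]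

protected theorem add_mul (f g h : AffineSchurAlgebra K n r) : (f + g) * h = f * h + g * h := by
  classical
  refine ext_coeff fun p q => ?_
  have hT1 : ∀ s, f.coeff (orb n p s) ≠ 0 → s ∈ f.row p ∪ g.row p ∪ (f + g).row p :=
    fun s hs => by simp [mem_row f p s hs]
  have hT2 : ∀ s, g.coeff (orb n p s) ≠ 0 → s ∈ f.row p ∪ g.row p ∪ (f + g).row p :=
    fun s hs => by simp [mem_row g p s hs]
  have hT3 : ∀ s, (f + g).coeff (orb n p s) ≠ 0 → s ∈ f.row p ∪ g.row p ∪ (f + g).row p :=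
    fun s hs => by simp [mem_row (f + g) p s hs]
  rw [coeff_add, coeff_mul _ _ p q _ hT1, coeff_mul _ _ p q _ hT2, coeff_mul _ _ p q _ hT3,
    ← Finset.sum_add_distrib]
  exact Finset.sum_congr rfl fun s _ => by rw [coeff_add, add_mul]

protected theorem zero_mul (f : AffineSchurAlgebra K n r) : 0 * f = 0 :=
  ext_coeff fun p q => by
    rw [coeff_mul _ _ p q ∅ (fun s hs => (hs (coeff_zero _)).elim), Finset.sum_empty, coeff_zero]

protected theorem mul_zero (f : AffineSchurAlgebra K n r) : f * 0 = 0 :=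
  ext_coeff fun p q => by
    rw [coeff_mul _ _ p q _ (mem_row f p), coeff_zero]
    exact Finset.sum_eq_zero fun s _ => by rw [coeff_zero, mul_zero]

protected theorem smul_mul (c : K) (f g : AffineSchurAlgebra K n r) :
    (c • f) * g = c • (f * g) :=
  ext_coeff fun p q => by
    rw [coeff_smul, coeff_mul _ _ p q _ (mem_row f p), coeff_mul _ _ p q (f.row p)
      (fun s hs => mem_row f p s fun h => hs (by rw [coeff_smul, h, mul_zero])), Finset.mul_sum]
    exact Finset.sum_congr rfl fun s _ => by rw [coeff_smul, mul_assoc]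

protected theorem mul_smul (c : K) (f g : AffineSchurAlgebra K n r) :
    f * (c • g) = c • (f * g) :=
  ext_coeff fun p q => by
    rw [coeff_smul, coeff_mul _ _ p q _ (mem_row f p), coeff_mul _ _ p q _ (mem_row f p),
      Finset.mul_sum]
    exact Finset.sum_congr rfl fun s _ => by rw [coeff_smul, mul_left_comm]

protected theorem mul_assoc (f g h : AffineSchurAlgebra K n r) : f * g * h = f * (g * h) := by
  classical
  refine ext_coeff fun p q => ?_
  let T : Finset (MultiIndex r) := (f * g).row p ∪ (f.row p).biUnion fun u => g.row u
  have hT1 : ∀ s, (f * g).coeff (orb n p s) ≠ 0 → s ∈ T := fun s hs =>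
    Finset.mem_union_left _ (mem_row _ p s hs)
  have hT2 : ∀ u ∈ f.row p, ∀ s, g.coeff (orb n u s) ≠ 0 → s ∈ T := fun u hu s hs =>
    Finset.mem_union_right _ (Finset.mem_biUnion.2 ⟨u, hu, mem_row _ u s hs⟩)
  rw [coeff_mul _ _ p q T hT1, coeff_mul _ _ p q _ (mem_row f p)]
  have h1 : ∀ s, (f * g).coeff (orb n p s) * h.coeff (orb n s q) = ∑ u ∈ f.row p,
      f.coeff (orb n p u) * g.coeff (orb n u s) * h.coeff (orb n s q) := fun s => by
    rw [coeff_mul _ _ p s _ (mem_row f p), Finset.sum_mul]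
  rw [Finset.sum_congr rfl fun s _ => h1 s, Finset.sum_comm]
  refine Finset.sum_congr rfl fun u hu => ?_
  rw [coeff_mul _ _ u q T (hT2 u hu), Finset.mul_sum]
  exact Finset.sum_congr rfl fun s _ => mul_assoc _ _ _

protected theorem one_mul [NeZero n] (f : AffineSchurAlgebra K n r) : 1 * f = f := by
  classical
  refine ext_coeff fun p q => ?_
  rw [coeff_mul _ _ p q {p} fun s hs => ?_, Finset.sum_singleton, coeff_one, if_pos rfl, one_mul]
  rw [coeff_one] at hs
  by_contra h
  exact hs (if_neg fun h' => h (by simp [h']))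

protected theorem mul_one [NeZero n] (f : AffineSchurAlgebra K n r) : f * 1 = f := by
  classical
  refine ext_coeff fun p q => ?_
  rw [coeff_mul _ _ p q (insert q (f.row p)) fun s hs =>
    Finset.mem_insert_of_mem (mem_row f p s hs)]
  simp [coeff_one]

instance instRing [NeZero n] : Ring (AffineSchurAlgebra K n r) :=
  { instAddCommGroup, instMul, instOne with
    left_distrib := AffineSchurAlgebra.mul_add
    right_distrib := AffineSchurAlgebra.add_mul
    zero_mul := AffineSchurAlgebra.zero_mul
    mul_zero := AffineSchurAlgebra.mul_zero
    mul_assoc := AffineSchurAlgebra.mul_assoc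
    one_mul := AffineSchurAlgebra.one_mul
    mul_one := AffineSchurAlgebra.mul_one }

instance instAlgebra [NeZero n] : Algebra K (AffineSchurAlgebra K n r) :=
  Algebra.ofModule AffineSchurAlgebra.smul_mul fun c f g => AffineSchurAlgebra.mul_smul c f g

end

end AffineSchurAlgebra

/-! An element of the affine Schur algebra is a row-finite matrix indexed by `r`-tuples and constant
on orbits, and `coeff_mul` is matrix multiplication. Sending `nq + c` to `(n+1)q + c`, for `0 ≤ c <
n`, embeds the tuples for `n` into those for `n + 1`, equivariantly, with image the tuples avoiding
the residue `n` mod `n + 1`. Padding with zeros then identifies `S̃(n, r)` with `e S̃(n+1, r) e`,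
where `e` is the sum of the `ξ_{i,i}` over the orbits of such tuples (`skipLinear_mul`,
`exists_skipHom_eq`).

The idempotent `e` is full. Since `r < n + 1`, a tuple `i` misses some residue mod `n + 1`, so some
translate `i + k` avoids `n`. Translation by a constant commutes with the group, hence `ξ_{i,i} =
ξ_{i,i+k} e ξ_{i+k,i}` (`xi_self_eq`), and these elements sum to `1`.

For a full idempotent `e` of `A`, the functor `M ↦ e M` from `A`-modules to `e A e`-modules is an
equivalence (`isMoritaEquivalent_of_full_idempotent`). -/

namespace FullIdempotent

open CategoryTheory
open scoped ModuleCat.Algebra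

universe u v w

/-! ### Morita equivalence from a full idempotent. -/

section Corner

variable {K : Type v} [CommRing K] {A : Type u} [Ring A] [Algebra K A] {B : Type u} [Ring B]
  [Algebra K B] (f : B →ₙₐ[K] A)

/-- The part `e M` of an `A`-module `M`, where `e = f 1`. -/
def cornerModule (M : Type w) [AddCommGroup M] [Module A M] : AddSubgroup M where
  carrier := {m | f 1 • m = m}
  add_mem' {x y} hx hy := by
    simp only [Set.mem_ofPred_eq] at hx hy ⊢
    rw [smul_add, hx, hy]
  zero_mem' := smul_zero _
  neg_mem' {x} hx := by
    simp only [Set.mem_ofPred_eq] at hx ⊢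
    rw [smul_neg, hx]

section

variable {f} {M : Type w} [AddCommGroup M] [Module A M]

theorem mem_cornerModule {m : M} : m ∈ cornerModule f M ↔ f 1 • m = m := Iff.rfl

theorem smul_mem_cornerModule (b : B) (m : M) : f b • m ∈ cornerModule f M := by
  rw [mem_cornerModule, smul_smul, ← map_mul, one_mul]

instance : SMul B (cornerModule f M) := ⟨fun b m => ⟨f b • (m : M), smul_mem_cornerModule b _⟩⟩

theorem coe_smul_cornerModule (b : B) (m : cornerModule f M) :
    ((b • m : cornerModule f M) : M) = f b • (m : M) := rfl

instance : Module B (cornerModule f M) where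
  one_smul m := Subtype.ext m.2
  mul_smul a b m := Subtype.ext <| by simp only [coe_smul_cornerModule, map_mul, mul_smul]
  smul_zero a := Subtype.ext <| smul_zero _
  smul_add a m m' := Subtype.ext <| smul_add _ _ _
  add_smul a b m := Subtype.ext <| by
    simp only [coe_smul_cornerModule, map_add, add_smul, AddSubgroup.coe_add]
  zero_smul m := Subtype.ext <| by
    simp only [coe_smul_cornerModule, map_zero, zero_smul, AddSubgroup.coe_zero]

variable {N : Type w} [AddCommGroup N] [Module A N]

/-- The restriction to `e M → e N` of an `A`-linear map `M → N`. -/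
def cornerMap (g : M →ₗ[A] N) : cornerModule f M →ₗ[B] cornerModule f N where
  toFun m := ⟨g m, by rw [mem_cornerModule, ← map_smul, mem_cornerModule.1 m.2]⟩
  map_add' m m' := Subtype.ext <| by simp
  map_smul' b m := Subtype.ext <| by simp [coe_smul_cornerModule]

variable {ι : Type*} {s : Finset ι} {x y : ι → A} (hfull : ∑ k ∈ s, x k * f 1 * y k = 1)
include hfull

/-- Fullness in module form: `M` is generated by `e M`, through explicit coefficients. -/
theorem sum_smul_eq_self (m : M) : ∑ k ∈ s, x k • f 1 • y k • m = m := by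
  conv_rhs => rw [← one_smul A m, ← hfull, Finset.sum_smul]
  simp only [mul_smul]

theorem cornerMap_injective : Function.Injective (cornerMap (f := f) (M := M) (N := N)) := by
  intro g h hgh
  ext m
  rw [← sum_smul_eq_self hfull m]
  simp only [map_sum]
  refine Finset.sum_congr rfl fun k _ => ?_
  rw [map_smul, map_smul h (x k)]
  congr 1
  exact congrArg Subtype.val (DFunLike.congr_fun hgh ⟨_, smul_mem_cornerModule 1 (y k • m)⟩)

/-- By `sum_smul_eq_self`, an extension of `φ` can only be `m ↦ ∑ x_k φ(e y_k m)`. This is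
`A`-linear because `φ` commutes with every element of `e A e`, which is the image of `B`. -/
theorem cornerMap_surjective (hrange : ∀ a, ∃ b, f b = f 1 * a * f 1) :
    Function.Surjective (cornerMap (f := f) (M := M) (N := N)) := by
  intro φ
  let c (m : M) : cornerModule f M := ⟨f 1 • m, smul_mem_cornerModule 1 m⟩
  have hc (m : cornerModule f M) : c m = m := Subtype.ext m.2
  have hφ (a : A) (m : M) : (φ (c (a • f 1 • m)) : N) = f 1 • a • φ (c m) := by
    obtain ⟨b, hb⟩ := hrange a
    have h1 : c (a • f 1 • m) = b • c m := Subtype.ext <| by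
      simp only [coe_smul_cornerModule, c, hb, mul_smul]
      rw [smul_smul (f 1) (f 1), ← map_mul, one_mul]
    rw [h1, map_smul, coe_smul_cornerModule, hb, mul_smul, mul_smul,
      mem_cornerModule.1 (φ (c m)).2]
  let ψ : M →ₗ[A] N :=
    { toFun := fun m => ∑ k ∈ s, x k • (φ (c (y k • m)) : N)
      map_add' := fun m m' => by
        rw [← Finset.sum_add_distrib]
        refine Finset.sum_congr rfl fun k _ => ?_
        have : c (y k • (m + m')) = c (y k • m) + c (y k • m') :=
          Subtype.ext <| by simp [c]
        rw [this, map_add, AddSubgroup.coe_add, smul_add]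
      map_smul' := fun a m => by
        have h1 (k : ι) : (φ (c (y k • a • m)) : N) =
            f 1 • y k • a • ∑ l ∈ s, x l • (φ (c (y l • m)) : N) := by
          -- Expanding `m` by fullness puts an `e` to the right of `y k * a * x l`, as `hφ`
          -- requires.
          have h2 : c (y k • a • m) = ∑ l ∈ s, c ((y k * a * x l) • f 1 • y l • m) := by
            refine Subtype.ext ?_
            rw [AddSubgroup.val_finsetSum]
            simp only [c, mul_smul]
            rw [← Finset.smul_sum, ← Finset.smul_sum, ← Finset.smul_sum,
              sum_smul_eq_self hfull m]
          rw [h2, map_sum, AddSubgroup.val_finsetSum]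
          simp only [Finset.smul_sum]
          exact Finset.sum_congr rfl fun l _ => by rw [hφ, mul_smul, mul_smul]
        simp only [h1, RingHom.id_apply]
        exact sum_smul_eq_self hfull _ }
  refine ⟨ψ, LinearMap.ext fun m => Subtype.ext ?_⟩
  change ∑ k ∈ s, x k • (φ (c (y k • (m : M))) : N) = φ m
  have h3 (k : ι) : (φ (c (y k • (m : M))) : N) = f 1 • y k • (φ m : N) := by
    conv_lhs => rw [← mem_cornerModule.1 m.2, hφ, hc]
  simp only [h3]
  exact sum_smul_eq_self hfull _

end

/-- The functor `M ↦ e M`, where `e = f 1`. -/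
def cornerFunctor : ModuleCat.{w} A ⥤ ModuleCat.{w} B where
  obj M := ModuleCat.of B (cornerModule f M)
  map g := ModuleCat.ofHom (cornerMap g.hom)
  map_id _ := rfl
  map_comp _ _ := rfl

/-- Although `f` is not unital, it sends `c • 1` to `c • e`, which acts on `e M` as the scalar `c`.
-/
instance cornerFunctor_linear : (cornerFunctor.{u, v, w} f).Linear K where
  map_smul {M N} g c := by
    refine ModuleCat.hom_ext <| LinearMap.ext fun (m : cornerModule f M) => Subtype.ext ?_
    change algebraMap K A c • g.hom (m : M) = f (algebraMap K B c) • g.hom (m : M)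
    rw [Algebra.algebraMap_eq_smul_one (A := B), map_smul, Algebra.smul_def, mul_smul,
      ← map_smul g.hom (f 1),
      mem_cornerModule.1 m.2]

/-- The `B`-linear maps from `e A` to `N`, as an `A`-module. -/
def Coinduced (N : Type w) [AddCommGroup N] [Module B N] : Type (max u w) :=
  cornerModule f A →ₗ[B] N

variable {f} in
/-- Right multiplication on `e A`. -/
def cornerMulRight (a : A) : cornerModule f A →ₗ[B] cornerModule f A :=
  cornerMap (LinearMap.toSpanSingleton A A a)

variable {f} in
theorem coe_cornerMulRight (a : A) (z : cornerModule f A) :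
    (cornerMulRight a z : A) = z * a := rfl

section

variable (N : Type w) [AddCommGroup N] [Module B N]

instance : AddCommGroup (Coinduced f N) := inferInstanceAs (AddCommGroup (_ →ₗ[B] _))

instance : SMul A (Coinduced f N) :=
  ⟨fun a φ => LinearMap.comp (show cornerModule f A →ₗ[B] N from φ) (cornerMulRight a)⟩

variable {f N}

/-- The value at an element of `e A`. -/
def Coinduced.eval (φ : Coinduced f N) (z : cornerModule f A) : N :=
  (show cornerModule f A →ₗ[B] N from φ) z

theorem Coinduced.ext {φ ψ : Coinduced f N} (h : ∀ z, φ.eval z = ψ.eval z) : φ = ψ :=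
  LinearMap.ext h

theorem Coinduced.eval_smul (a : A) (φ : Coinduced f N) (z : cornerModule f A) :
    (a • φ).eval z = φ.eval (cornerMulRight a z) := rfl

theorem Coinduced.eval_add (φ ψ : Coinduced f N) (z : cornerModule f A) :
    (φ + ψ).eval z = φ.eval z + ψ.eval z := rfl

theorem Coinduced.eval_map_add (φ : Coinduced f N) (z z' : cornerModule f A) :
    φ.eval (z + z') = φ.eval z + φ.eval z' := LinearMap.map_add _ _ _

theorem Coinduced.eval_map_smul (φ : Coinduced f N) (b : B) (z : cornerModule f A) :
    φ.eval (b • z) = b • φ.eval z := LinearMap.map_smul _ _ _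

instance : Module A (Coinduced f N) where
  one_smul φ := Coinduced.ext fun z => congrArg φ.eval (Subtype.ext (mul_one (z : A)))
  mul_smul a b φ := Coinduced.ext fun z =>
    congrArg φ.eval (Subtype.ext (mul_assoc (z : A) a b).symm)
  smul_zero a := rfl
  smul_add a φ ψ := rfl
  add_smul a b φ := Coinduced.ext fun z => by
    rw [Coinduced.eval_add, Coinduced.eval_smul, Coinduced.eval_smul, Coinduced.eval_smul,
      ← Coinduced.eval_map_add]
    exact congrArg φ.eval (Subtype.ext (mul_add (z : A) a b))
  zero_smul φ := Coinduced.ext fun z => by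
    rw [Coinduced.eval_smul]
    have : cornerMulRight (0 : A) z = 0 := Subtype.ext (mul_zero (z : A))
    rw [this]
    exact LinearMap.map_zero _

variable (f) in
/-- The idempotent `e` as an element of `e A`. -/
def cornerOne : cornerModule f A := ⟨f 1, by rw [mem_cornerModule, smul_eq_mul, ← map_mul, one_mul]⟩

/-- Evaluation at `e`, from `e Hom_B(e A, N)` to `N`. -/
def evalOne : cornerModule f (Coinduced f N) →ₗ[B] N where
  toFun φ := (φ : Coinduced f N).eval (cornerOne f)
  map_add' _ _ := rfl
  map_smul' b φ := by
    rw [coe_smul_cornerModule, Coinduced.eval_smul, RingHom.id_apply, ← Coinduced.eval_map_smul]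
    refine congrArg (Coinduced.eval _) (Subtype.ext ?_)
    rw [coe_cornerMulRight, coe_smul_cornerModule, cornerOne, smul_eq_mul, ← map_mul, ← map_mul,
      one_mul, mul_one]

/-- If `e φ = φ`, then `φ(z) = φ(z e)`. For `z` in `e A`, the element `z e` lies in `e A e`, so it
is `f b` for a unique `b`, and `φ(z) = b φ(e)`. Thus `φ` is determined by `φ(e)`, which can be
arbitrary. -/
theorem evalOne_bijective (hinj : Function.Injective f)
    (hrange : ∀ a, ∃ b, f b = f 1 * a * f 1) :
    Function.Bijective (evalOne (f := f) (N := N)) := by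
  choose g hg using hrange
  have hself (φ : cornerModule f (Coinduced f N)) (z : cornerModule f A) :
      (φ : Coinduced f N).eval z = g (z : A) • evalOne φ := by
    have h1 : (φ : Coinduced f N).eval (cornerMulRight (f 1) z) = (φ : Coinduced f N).eval z := by
      rw [← Coinduced.eval_smul, mem_cornerModule.1 φ.2]
    rw [← h1]
    change _ = g (z : A) • (φ : Coinduced f N).eval (cornerOne f)
    rw [← Coinduced.eval_map_smul]
    refine congrArg (Coinduced.eval _) (Subtype.ext ?_)
    rw [coe_cornerMulRight, coe_smul_cornerModule, cornerOne, smul_eq_mul, ← map_mul,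
      mul_one, hg, ← smul_eq_mul (f 1) (z : A), mem_cornerModule.1 z.2]
  constructor
  · intro φ ψ h
    exact Subtype.ext <| Coinduced.ext fun z => by rw [hself, hself, h]
  · intro m
    -- Linearity of this map follows from injectivity of `f`, by comparing `e z e` for the arguments
    -- involved.
    let φ : Coinduced f N :=
      LinearMap.mk (AddHom.mk (fun z : cornerModule f A => g (z : A) • m)
        fun z z' => by
          rw [← add_smul]
          congr 1
          apply hinj
          rw [map_add, hg, hg, hg, AddSubgroup.coe_add, mul_add, add_mul])
        fun b z => by
          change g _ • m = b • g _ • m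
          rw [smul_smul]
          congr 1
          apply hinj
          rw [map_mul, hg, hg, coe_smul_cornerModule, smul_eq_mul, ← mul_assoc, ← mul_assoc,
            ← map_mul, one_mul, ← mul_assoc, ← map_mul, mul_one]
    have hφ (z : cornerModule f A) : φ.eval z = g (z : A) • m := rfl
    refine ⟨⟨φ, ?_⟩, ?_⟩
    · refine Coinduced.ext fun z => ?_
      rw [Coinduced.eval_smul, hφ, hφ]
      congr 1
      apply hinj
      rw [hg, hg, coe_cornerMulRight, mul_assoc, mul_assoc, ← map_mul, one_mul, mul_assoc]
    · change g (f 1) • m = m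
      have : g (f 1) = 1 := hinj <| by rw [hg, ← map_mul, ← map_mul, one_mul, one_mul]
      rw [this, one_smul]

end

end Corner

/-- Morita equivalence of `A` and `B ≅ e A e` for a full idempotent `e` of `A`. -/
theorem isMoritaEquivalent_of_full_idempotent {K : Type v} [CommRing K] {A : Type u} [Ring A]
    [Algebra K A] {B : Type u} [Ring B] [Algebra K B] (f : B →ₙₐ[K] A)
    (hinj : Function.Injective f) (hrange : ∀ a, ∃ b, f b = f 1 * a * f 1)
    {ι : Type*} {s : Finset ι} {x y : ι → A} (hfull : ∑ k ∈ s, x k * f 1 * y k = 1) :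
    IsMoritaEquivalent K A B := by
  have h1 : (cornerFunctor.{u, v, u} f).Faithful :=
    ⟨fun {M N} g h hgh => ModuleCat.hom_ext <|
      cornerMap_injective hfull (congrArg ModuleCat.Hom.hom hgh)⟩
  have h2 : (cornerFunctor.{u, v, u} f).Full :=
    ⟨fun {M N} φ => by
      obtain ⟨ψ, hψ⟩ := cornerMap_surjective hfull hrange φ.hom
      exact ⟨ModuleCat.ofHom ψ, ModuleCat.hom_ext hψ⟩⟩
  -- Modules live in the universe `u` of `A` and `B`, so `Coinduced f N` stays in the same category.
  have h3 : (cornerFunctor.{u, v, u} f).EssSurj :=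
    ⟨fun N => ⟨ModuleCat.of A (Coinduced f N),
      ⟨(LinearEquiv.ofBijective (evalOne (f := f) (N := N))
        (evalOne_bijective hinj hrange)).toModuleIso⟩⟩⟩
  have h4 : (cornerFunctor.{u, v, u} f).IsEquivalence := { }
  exact ⟨⟨⟨(cornerFunctor.{u, v, u} f).asEquivalence, cornerFunctor_linear f⟩⟩⟩

end FullIdempotent

/-! ### Skipping one residue class, and translating tuples. -/

namespace AffineSchur

/-- The increasing bijection from `ℤ` onto the integers that are not congruent to `n` modulo
`n + 1`. -/
def skip (n : ℕ) (a : ℤ) : ℤ := a + a / n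

section

variable {n : ℕ} [NeZero n]

/-- This turns shifts by `n` into shifts by `n + 1`, making `skipIndex` equivariant with the same
`σ` and `ε`. -/
theorem skip_add_mul (a k : ℤ) : skip n (a + n * k) = skip n a + (n + 1 : ℕ) * k := by
  have hn : (n : ℤ) ≠ 0 := by exact_mod_cast NeZero.ne n
  rw [skip, skip, Int.add_mul_ediv_left _ _ hn]
  push_cast
  ring

/-- Quotient and remainder are unchanged, only the modulus grows; injectivity and the image of
`skip` are read off from this. -/
theorem skip_ediv_emod (a : ℤ) :
    skip n a / (n + 1 : ℕ) = a / n ∧ skip n a % (n + 1 : ℕ) = a % n := by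
  have hn : (0 : ℤ) < n := by exact_mod_cast Nat.pos_of_ne_zero (NeZero.ne n)
  have h0 := Int.emod_nonneg a hn.ne'
  have h1 := Int.emod_lt_of_pos a hn
  refine (Int.ediv_emod_unique (by positivity)).2 ⟨?_, h0, by push_cast; lia⟩
  have := Int.emod_add_mul_ediv a n
  rw [skip]
  push_cast
  linear_combination this

theorem skip_injective : Function.Injective (skip n) := by
  intro a b h
  have ha := skip_ediv_emod (n := n) a
  have hb := skip_ediv_emod (n := n) b
  rw [h] at ha
  rw [← Int.emod_add_mul_ediv a n, ← Int.emod_add_mul_ediv b n, ← ha.1, ← ha.2, hb.1, hb.2]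

theorem mem_range_skip {b : ℤ} : b ∈ Set.range (skip n) ↔ b % (n + 1 : ℕ) ≠ n := by
  have hn : (0 : ℤ) < n := by exact_mod_cast Nat.pos_of_ne_zero (NeZero.ne n)
  constructor
  · rintro ⟨a, rfl⟩
    rw [(skip_ediv_emod a).2]
    exact (Int.emod_lt_of_pos a hn).ne
  · intro h
    have h0 := Int.emod_nonneg b (b := (n + 1 : ℕ)) (by positivity)
    have h1 := Int.emod_lt_of_pos b (b := (n + 1 : ℕ)) (by positivity)
    have h2 : b % (n + 1 : ℕ) < n := by push_cast at h h1 ⊢; lia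
    refine ⟨b % (n + 1 : ℕ) + n * (b / (n + 1 : ℕ)), ?_⟩
    rw [skip_add_mul, skip, Int.ediv_eq_zero_of_lt h0 h2, add_zero, Int.emod_add_mul_ediv]

end

section

variable (n : ℕ) {r : ℕ}

/-- The entrywise application of `skip n`. -/
def skipIndex (i : MultiIndex r) : MultiIndex r := fun t => skip n (i t)

/-- The entrywise translation by `k`. -/
def translate (k : ℤ) (i : MultiIndex r) : MultiIndex r := fun t => i t + k

theorem act_translate (σ : Equiv.Perm (Fin r)) (ε : Fin r → ℤ) (k : ℤ) (i : MultiIndex r) :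
    act n σ ε (translate k i) = translate k (act n σ ε i) := by
  ext t
  simp only [act, translate, Equiv.coe_fn_mk]
  ring

theorem translate_injective (k : ℤ) : Function.Injective (translate (r := r) k) :=
  fun _ _ h => funext fun t => add_right_cancel (congrFun h t)

variable {n}

theorem orb_swap {i j k l : MultiIndex r} : orb n i j = orb n k l ↔ orb n j i = orb n l k := by
  simp only [orb_eq_iff, and_comm]

/-- Translation commutes with the group, so the orbit of `(i, i + k)` is the graph of translation by
`k` on the orbit of `i`. Hence `ξ_{i,i+k}` has at most one nonzero entry in each row. -/
theorem orb_translate_eq_iff {k : ℤ} {i p s : MultiIndex r} :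
    orb n i (translate k i) = orb n p s ↔ s = translate k p ∧ orb n i i = orb n p p := by
  simp only [orb_eq_iff, act_translate]
  constructor
  · rintro ⟨σ, ε, rfl, rfl⟩
    exact ⟨rfl, σ, ε, rfl, rfl⟩
  · rintro ⟨rfl, σ, ε, rfl, -⟩
    exact ⟨σ, ε, rfl, rfl⟩

variable [NeZero n]

theorem act_skipIndex (σ : Equiv.Perm (Fin r)) (ε : Fin r → ℤ) (i : MultiIndex r) :
    act (n + 1) σ ε (skipIndex n i) = skipIndex n (act n σ ε i) :=
  funext fun _ => (skip_add_mul _ _).symm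

theorem skipIndex_injective : Function.Injective (skipIndex (r := r) n) :=
  fun _ _ h => funext fun t => skip_injective (congrFun h t)

theorem mem_range_skipIndex {p : MultiIndex r} :
    p ∈ Set.range (skipIndex n) ↔ ∀ t, p t % (n + 1 : ℕ) ≠ n := by
  simp only [← mem_range_skip]
  constructor
  · rintro ⟨i, rfl⟩ t
    exact ⟨i t, rfl⟩
  · intro h
    choose i hi using h
    exact ⟨i, funext hi⟩

theorem act_mem_range_skipIndex (σ : Equiv.Perm (Fin r)) (ε : Fin r → ℤ) {p : MultiIndex r}
    (hp : p ∈ Set.range (skipIndex n)) : act (n + 1) σ ε p ∈ Set.range (skipIndex n) := by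
  obtain ⟨i, rfl⟩ := hp
  exact ⟨_, (act_skipIndex σ ε i).symm⟩

theorem mem_range_skipIndex_of_orb_eq {i j p q : MultiIndex r}
    (h : orb (n + 1) i j = orb (n + 1) p q) (hi : i ∈ Set.range (skipIndex n)) :
    p ∈ Set.range (skipIndex n) := by
  obtain ⟨σ, ε, rfl, -⟩ := orb_eq_iff.1 h
  exact act_mem_range_skipIndex σ ε hi

theorem orb_skipIndex_eq_iff {i j k l : MultiIndex r} :
    orb (n + 1) (skipIndex n i) (skipIndex n j) = orb (n + 1) (skipIndex n k) (skipIndex n l) ↔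
      orb n i j = orb n k l := by
  simp only [orb_eq_iff, act_skipIndex, skipIndex_injective.eq_iff]

variable (n) in
/-- The map on orbits of pairs induced by `skipIndex n`. -/
def skipOrbit : Orbit n r → Orbit (n + 1) r :=
  Quotient.lift (s := orbitSetoid n r) (fun x => orb (n + 1) (skipIndex n x.1) (skipIndex n x.2))
    fun _ _ h => orb_skipIndex_eq_iff.2 (Quotient.sound h)

theorem skipOrbit_orb (i j : MultiIndex r) :
    skipOrbit n (orb n i j) = orb (n + 1) (skipIndex n i) (skipIndex n j) := rfl

theorem skipOrbit_injective : Function.Injective (skipOrbit (r := r) n) := by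
  intro a b h
  obtain ⟨i, j, rfl⟩ := exists_orb a
  obtain ⟨k, l, rfl⟩ := exists_orb b
  exact orb_skipIndex_eq_iff.1 h

/-- If `r ≤ n`, then some translate of `i` has no entry congruent to `n` modulo `n + 1`. -/
theorem exists_translate_mem_range_skipIndex (hrn : r ≤ n) (i : MultiIndex r) :
    ∃ k, translate k i ∈ Set.range (skipIndex n) := by
  -- Pigeonhole: `r` entries cannot cover `n + 1 > r` residues.
  have h : ¬ Function.Surjective fun t : Fin r => ((i t : ℤ) : ZMod (n + 1)) := fun h => by
    have := Fintype.card_le_of_surjective _ h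
    rw [ZMod.card, Fintype.card_fin] at this
    lia
  simp only [Function.Surjective, not_forall, not_exists] at h
  obtain ⟨c, hc⟩ := h
  obtain ⟨c, rfl⟩ := ZMod.intCast_surjective c
  -- Translation by `n - c` moves the missed residue `c` to `n`.
  refine ⟨n - c, mem_range_skipIndex.2 fun t ht => hc t ?_⟩
  have h1 : ((i t + (n - c) : ℤ) : ZMod (n + 1)) = ((n : ℤ) : ZMod (n + 1)) := by
    rw [ZMod.intCast_eq_intCast_iff]
    refine Eq.trans ht (Int.emod_eq_of_lt (by positivity) (by push_cast; lia)).symm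
  push_cast at h1
  linear_combination h1

end

end AffineSchur

/-! ### The smaller Schur algebra as a full corner of the larger one. -/

namespace AffineSchurAlgebra

open AffineSchur

noncomputable section

variable {K : Type*} [CommRing K] {n r : ℕ}

open Classical in
theorem coeff_xi (i j : MultiIndex r) (o : Orbit n r) :
    (xi K n i j).coeff o = if orb n i j = o then 1 else 0 :=
  Finsupp.single_apply

open Classical in
-- Left multiplication by a partial permutation matrix replaces row `p` by row `p + k`, or by zero
-- when `p` is outside the orbit of `i`.
theorem coeff_xi_translate_mul (k : ℤ) (i p q : MultiIndex r) (g : AffineSchurAlgebra K n r) :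
    (xi K n i (translate k i) * g).coeff (orb n p q) =
      if orb n i i = orb n p p then g.coeff (orb n (translate k p) q) else 0 := by
  have h (s : MultiIndex r) : (xi K n i (translate k i)).coeff (orb n p s) =
      if s = translate k p ∧ orb n i i = orb n p p then 1 else 0 := by
    rw [coeff_xi]
    exact if_congr orb_translate_eq_iff rfl rfl
  rw [coeff_mul _ _ p q {translate k p} fun s hs => ?_, Finset.sum_singleton, h]
  · simp
  · rw [h] at hs
    rw [Finset.mem_singleton]
    by_contra hs'
    exact hs (if_neg fun h => hs' h.1)

variable [NeZero n]

/-- The linear map `S̃(n, r) → S̃(n + 1, r)` that sends `ξ_{i,j}` to the basis element of the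
images of `i` and `j` under `skipIndex n`. -/
def skipLinear : AffineSchurAlgebra K n r →ₗ[K] AffineSchurAlgebra K (n + 1) r :=
  Finsupp.lmapDomain K K (skipOrbit n)

theorem coeff_skipLinear (x : AffineSchurAlgebra K n r) (i j : MultiIndex r) :
    (skipLinear x).coeff (orb (n + 1) (skipIndex n i) (skipIndex n j)) = x.coeff (orb n i j) :=
  Finsupp.mapDomain_apply skipOrbit_injective x (orb n i j)

theorem coeff_skipLinear_of_not_mem (x : AffineSchurAlgebra K n r) {p q : MultiIndex r}
    (h : ¬ (p ∈ Set.range (skipIndex n) ∧ q ∈ Set.range (skipIndex n))) :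
    (skipLinear x).coeff (orb (n + 1) p q) = 0 := by
  refine Finsupp.mapDomain_of_notMem_range x (orb (n + 1) p q) ?_
  rintro ⟨o, ho⟩
  obtain ⟨i, j, rfl⟩ := exists_orb o
  rw [skipOrbit_orb] at ho
  exact h ⟨mem_range_skipIndex_of_orb_eq ho ⟨i, rfl⟩,
    mem_range_skipIndex_of_orb_eq (orb_swap.1 ho) ⟨j, rfl⟩⟩

theorem skipLinear_injective : Function.Injective (skipLinear (K := K) (n := n) (r := r)) :=
  Finsupp.mapDomain_injective skipOrbit_injective

/-- The image of `x` is the matrix `x` padded by zero rows and columns outside the range of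
`skipIndex`, so the sum over intermediate tuples only sees that range. -/
theorem skipLinear_mul (x y : AffineSchurAlgebra K n r) :
    skipLinear (x * y) = skipLinear x * skipLinear y := by
  classical
  refine ext_coeff fun p q => ?_
  by_cases hp : p ∈ Set.range (skipIndex n)
  · obtain ⟨i, rfl⟩ := hp
    have hT (s : MultiIndex r)
        (hs : (skipLinear x).coeff (orb (n + 1) (skipIndex n i) s) ≠ 0) :
        s ∈ (x.row i).image (skipIndex n) := by
      by_cases h : s ∈ Set.range (skipIndex n)
      · obtain ⟨j, rfl⟩ := h
        rw [coeff_skipLinear] at hs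
        exact Finset.mem_image_of_mem _ (mem_row x i j hs)
      · exact (hs (coeff_skipLinear_of_not_mem x fun h' => h h'.2)).elim
    rw [coeff_mul _ _ _ q _ hT, Finset.sum_image skipIndex_injective.injOn]
    by_cases hq : q ∈ Set.range (skipIndex n)
    · obtain ⟨j, rfl⟩ := hq
      simp only [coeff_skipLinear]
      exact coeff_mul x y i j _ (mem_row x i)
    · rw [coeff_skipLinear_of_not_mem _ fun h => hq h.2]
      exact (Finset.sum_eq_zero fun s _ => by
        rw [coeff_skipLinear_of_not_mem y fun h => hq h.2, mul_zero]).symm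
  · rw [coeff_skipLinear_of_not_mem _ fun h => hp h.1, coeff_mul _ _ p q ∅
      fun s hs => (hs (coeff_skipLinear_of_not_mem x fun h => hp h.1)).elim, Finset.sum_empty]

/-- The non-unital algebra homomorphism `S̃(n, r) → S̃(n + 1, r)` given by `skipLinear`. -/
def skipHom (K : Type*) [CommRing K] (n r : ℕ) [NeZero n] :
    AffineSchurAlgebra K n r →ₙₐ[K] AffineSchurAlgebra K (n + 1) r where
  toFun := skipLinear
  map_smul' := map_smul skipLinear
  map_zero' := map_zero skipLinear
  map_add' := map_add skipLinear
  map_mul' := skipLinear_mul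

open Classical in
-- The idempotent `e` is a diagonal 0/1 matrix, so multiplying by it on the left or right truncates
-- rows or columns.
theorem coeff_skipHom_one (p q : MultiIndex r) :
    (skipHom K n r 1).coeff (orb (n + 1) p q) =
      if p = q ∧ p ∈ Set.range (skipIndex n) then 1 else 0 := by
  change (skipLinear 1).coeff _ = _
  by_cases h : p ∈ Set.range (skipIndex n) ∧ q ∈ Set.range (skipIndex n)
  · obtain ⟨⟨i, rfl⟩, ⟨j, rfl⟩⟩ := h
    rw [coeff_skipLinear, coeff_one]
    simp [skipIndex_injective.eq_iff]
  · rw [coeff_skipLinear_of_not_mem _ h, if_neg]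
    rintro ⟨rfl, h'⟩
    exact h ⟨h', h'⟩

open Classical in
theorem coeff_skipHom_one_mul (g : AffineSchurAlgebra K (n + 1) r) (p q : MultiIndex r) :
    (skipHom K n r 1 * g).coeff (orb (n + 1) p q) =
      if p ∈ Set.range (skipIndex n) then g.coeff (orb (n + 1) p q) else 0 := by
  rw [coeff_mul _ _ p q {p} fun s hs => ?_, Finset.sum_singleton, coeff_skipHom_one]
  · simp
  · rw [coeff_skipHom_one] at hs
    by_contra h
    exact hs (if_neg fun h' => h (by simp [h'.1]))

open Classical in
theorem coeff_mul_skipHom_one (g : AffineSchurAlgebra K (n + 1) r) (p q : MultiIndex r) :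
    (g * skipHom K n r 1).coeff (orb (n + 1) p q) =
      if q ∈ Set.range (skipIndex n) then g.coeff (orb (n + 1) p q) else 0 := by
  rw [coeff_mul _ _ p q (insert q (g.row p)) fun s hs =>
    Finset.mem_insert_of_mem (mem_row g p s hs)]
  rw [Finset.sum_eq_single_of_mem q (Finset.mem_insert_self _ _) fun s _ hs => by
    rw [coeff_skipHom_one, if_neg fun h => hs h.1, mul_zero], coeff_skipHom_one]
  simp

/-- The image of `skipHom` is the whole corner of the idempotent `skipHom 1`. -/
theorem exists_skipHom_eq (a : AffineSchurAlgebra K (n + 1) r) :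
    ∃ b, skipHom K n r b = skipHom K n r 1 * a * skipHom K n r 1 := by
  classical
  -- The preimage is the submatrix of `a` on the range of `skipIndex`.
  let b : AffineSchurAlgebra K n r :=
    Finsupp.comapDomain (M := K) (skipOrbit n) a skipOrbit_injective.injOn
  have hb (i j : MultiIndex r) :
      b.coeff (orb n i j) = a.coeff (orb (n + 1) (skipIndex n i) (skipIndex n j)) :=
    Finsupp.comapDomain_apply _ _ _ _
  refine ⟨b, ext_coeff fun p q => ?_⟩
  rw [coeff_mul_skipHom_one, coeff_skipHom_one_mul]
  change (skipLinear b).coeff _ = _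
  by_cases h : p ∈ Set.range (skipIndex n) ∧ q ∈ Set.range (skipIndex n)
  · rw [if_pos h.2, if_pos h.1]
    obtain ⟨⟨i, rfl⟩, ⟨j, rfl⟩⟩ := h
    rw [coeff_skipLinear, hb]
  · rw [coeff_skipLinear_of_not_mem _ h]
    split_ifs with h1 h2
    · exact (h ⟨h2, h1⟩).elim
    · rfl
    · rfl

/-- The factor `ξ_{i,i+k}` moves each `p` in the orbit of `i` to `p + k`, and `ξ_{i+k,i}` moves it
back. In between `e` acts as the identity, since the range of `skipIndex` is stable under the group.
-/
theorem xi_self_eq {k : ℤ} {i : MultiIndex r} (h : translate k i ∈ Set.range (skipIndex n)) :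
    xi K (n + 1) i (translate k i) * skipHom K n r 1 * xi K (n + 1) (translate k i) i =
      xi K (n + 1) i i := by
  classical
  refine ext_coeff fun p q => ?_
  rw [mul_assoc, coeff_xi_translate_mul, coeff_skipHom_one_mul, coeff_xi, coeff_xi]
  by_cases hip : orb (n + 1) i i = orb (n + 1) p p
  · have hp : translate k p ∈ Set.range (skipIndex n) := by
      obtain ⟨σ, ε, rfl, -⟩ := orb_eq_iff.1 hip
      rw [← act_translate]
      exact act_mem_range_skipIndex σ ε h
    rw [if_pos hip, if_pos hp]
    refine if_congr ?_ rfl rfl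
    rw [orb_swap, orb_translate_eq_iff, (translate_injective k).eq_iff]
    constructor
    · rintro ⟨rfl, h'⟩
      exact h'
    · intro h'
      obtain rfl := (orb_eq_diagonal_iff p q).1 ⟨i, h'.symm⟩
      exact ⟨rfl, h'⟩
  · rw [if_neg hip, if_neg fun h' => hip ?_]
    obtain rfl := (orb_eq_diagonal_iff p q).1 ⟨i, h'.symm⟩
    exact h'

end

end AffineSchurAlgebra

/-! ### Conclusion. -/

open AffineSchur AffineSchurAlgebra in
/-- If `n ≥ r` (and `n ≥ 1`), then the affine Schur algebras `S̃(n+1, r)` and `S̃(n, r)` over an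
infinite field `K` are Morita equivalent, as `K`-algebras. -/
theorem theoremT (K : Type*) [Field K] [Infinite K] (n r : ℕ) [NeZero n] (hrn : r ≤ n) :
    IsMoritaEquivalent K (AffineSchurAlgebra K (n + 1) r) (AffineSchurAlgebra K n r) := by
  choose k hk using exists_translate_mem_range_skipIndex (n := n) (r := r) hrn
  -- Membership sits inside the existential so that the chosen `i` is defined on all orbits;
  -- non-diagonal ones get the dummy value `0`.
  have hrep (o : Orbit (n + 1) r) : ∃ i : MultiIndex r,
      o ∈ (finite_diagonal (n + 1) r).toFinset → orb (n + 1) i i = o := by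
    by_cases h : o ∈ (finite_diagonal (n + 1) r).toFinset
    · obtain ⟨i, hi⟩ := (Set.Finite.mem_toFinset _).1 h
      exact ⟨i, fun _ => hi.symm⟩
    · exact ⟨0, fun h' => (h h').elim⟩
  choose i hi using hrep
  refine FullIdempotent.isMoritaEquivalent_of_full_idempotent (skipHom K n r)
    skipLinear_injective exists_skipHom_eq
    (s := (finite_diagonal (n + 1) r).toFinset)
    (x := fun o => xi K (n + 1) (i o) (translate (k (i o)) (i o)))
    (y := fun o => xi K (n + 1) (translate (k (i o)) (i o)) (i o)) ?_
  -- By definition `1` is the sum over the same set of diagonal orbits, so the comparison is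
  -- termwise.
  refine Finset.sum_congr rfl fun o ho => ?_
  rw [xi_self_eq (hk (i o)), xi, hi o ho]
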